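/- Let $\Delta \ge 3$ be an integer and let $G=(V,E)$ be a finite undirected graph, possibly with multiple edges or loops, of maximum degree at most $\Delta$ (a loop contributes $2$ to the degree of its vertex). For $\beta\in\mathbb{C}$ let $$Z_{\mathrm{Ising}}(G;\beta)=\sum_{\sigma\colon V\to\{0,1\}}\beta^{m(\sigma)}$$ be the partition function of the Ising model, where $m(\sigma)$ is the number of monochromatic edges of $G$ under $\sigma$, that is, edges whose two ends are assigned the same value by $\sigma$. Let $\varepsilon_\Delta=\tan\bigl(\pi/(4(\Delta-1))\bigr)$. Then $\varepsilon_\Delta\in(0,1)$, and $Z_{\mathrm{Ising}}(G;\beta)\neq 0$ for every $\beta\in\mathbb{C}$ with $\beta\neq -1$ and $|\beta-1|/|\beta+1|\le\varepsilon_\Delta$. -/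

import Mathlib

open scoped Graph

namespace Ising

variable {α ε : Type*}

/-- The degree of the vertex `v` in the multigraph `G`: the number of edges incident with `v`, where
a loop is counted twice. -/
noncomputable def degree (G : Graph α ε) (v : α) : ℕ :=
  (G.incidenceSet v).ncard + (G.loopSet v).ncard

/-- `G` has maximum degree at most `Δ`. -/
def MaxDegreeLE (G : Graph α ε) (Δ : ℕ) : Prop :=
  ∀ v ∈ V(G), degree G v ≤ Δ

/-- The set of edges of `G` that are monochromatic under `σ`, i.e. whose two ends get the same
spin. In particular every loop is monochromatic. -/
def monochromaticEdges (G : Graph α ε) (σ : V(G) → Fin 2) : Set ε :=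
  {e | ∃ x y : V(G), G.IsLink e x y ∧ σ x = σ y}

/-- The partition function of the Ising model on the finite multigraph `G` with edge
interaction `β`: the sum of `β ^ m(σ)` over all assignments `σ` of spins `0`, `1` to the vertices,
`m(σ)` being the number of monochromatic edges. -/
noncomputable def partitionFunction (G : Graph α ε) (β : ℂ) : ℂ :=
  ∑ᶠ σ : V(G) → Fin 2, β ^ (monochromaticEdges G σ).ncard

/-- The radius `tan (π / (4 (Δ - 1)))`. -/
noncomputable def radius (Δ : ℕ) : ℝ :=
  Real.tan (Real.pi / (4 * ((Δ : ℝ) - 1)))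

end Ising

/-! ### Angles between complex numbers, and the effect of one edge. -/

namespace Ising

/-! Put φ = 2θ = π / (2(Δ - 1)). Cut edges into half-edges that may be pinned to a spin. By
induction on the number of free half-edges, Z ≠ 0 and the values of Z with one half-edge pinned to 0
or to 1 are at angle at most φ (`angleLE_pin_singleton`). If the other end of that edge is at u,
condition on the spin c of u: the two values are proportional to βS₀ + S₁ and S₀ + βS₁, where S_c
omits the edge. S₀ and S₁ differ by repinning at most Δ - 1 half-edges, so their angle is at most (Δ
- 1)φ = π/2, and `angleLE_edge` returns the angle φ. Nonvanishing follows by conditioning on a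
vertex: the two terms are at angle at most Δφ < π, so they cannot cancel. -/

/-- `a` is obtained from `b ≠ 0` by a positive scaling and a rotation by an angle of modulus at
most `φ`. -/
def AngleLE (φ : ℝ) (a b : ℂ) : Prop :=
  b ≠ 0 ∧ ∃ r t : ℝ, 0 < r ∧ |t| ≤ φ ∧ a = r * Complex.exp (t * Complex.I) * b

lemma AngleLE.refl {b : ℂ} (hb : b ≠ 0) : AngleLE 0 b b :=
  ⟨hb, 1, 0, one_pos, by simp, by simp⟩

lemma AngleLE.ne_zero_left {φ : ℝ} {a b : ℂ} (h : AngleLE φ a b) : a ≠ 0 := by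
  obtain ⟨hb, r, t, hr, -, rfl⟩ := h
  have : (r : ℂ) ≠ 0 := by exact_mod_cast hr.ne'
  simp [this, hb, Complex.exp_ne_zero]

/-- Because the angle is an existential real number and not `Complex.arg`, bounds add without
wrapping around. -/
lemma AngleLE.trans {φ ψ : ℝ} {a b c : ℂ} (h : AngleLE φ a b) (h' : AngleLE ψ b c) :
    AngleLE (φ + ψ) a c := by
  obtain ⟨-, r, t, hr, ht, rfl⟩ := h
  obtain ⟨hc, r', t', hr', ht', rfl⟩ := h'
  refine ⟨hc, r * r', t + t', mul_pos hr hr', (abs_add_le _ _).trans (add_le_add ht ht'), ?_⟩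
  push_cast
  rw [add_mul, Complex.exp_add]
  ring

lemma AngleLE.of_mul_left {φ : ℝ} {a b c : ℂ} (hc : c ≠ 0) (h : AngleLE φ (c * a) (c * b)) :
    AngleLE φ a b := by
  obtain ⟨hb, r, t, hr, ht, e⟩ := h
  refine ⟨right_ne_zero_of_mul hb, r, t, hr, ht, mul_left_cancel₀ hc ?_⟩
  rw [e]; ring

lemma AngleLE.mul_left {φ : ℝ} {a b c : ℂ} (hc : c ≠ 0) (h : AngleLE φ a b) :
    AngleLE φ (c * a) (c * b) := by
  obtain ⟨hb, r, t, hr, ht, e⟩ := h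
  refine ⟨mul_ne_zero hc hb, r, t, hr, ht, ?_⟩
  rw [e]; ring

lemma AngleLE.add_ne_zero {φ : ℝ} {a b : ℂ} (h : AngleLE φ a b) (hφ : φ < Real.pi) :
    a + b ≠ 0 := by
  obtain ⟨hb, r, t, hr, ht, rfl⟩ := h
  intro h0
  have h1 : (r : ℂ) * Complex.exp (t * Complex.I) + 1 = 0 := by
    refine (mul_eq_zero.1 (?_ : _ * b = 0)).resolve_right hb
    rw [← h0]; ring
  have hre := congrArg Complex.re h1
  have him := congrArg Complex.im h1
  simp [Complex.exp_ofReal_mul_I_re, Complex.exp_ofReal_mul_I_im, hr.ne'] at hre him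
  obtain ⟨h2, h3⟩ := abs_lt.1 (ht.trans_lt hφ)
  rw [(Real.sin_eq_zero_iff_of_lt_of_lt h2 h3).1 him] at hre
  simp at hre
  linarith

/-- ‖a + b‖² - ‖a - b‖² is four times the inner product of a and b, which is nonnegative up to a
right angle. -/
lemma AngleLE.norm_sub_le {φ : ℝ} {a b : ℂ} (h : AngleLE φ a b) (hφ : φ ≤ Real.pi / 2) :
    ‖a - b‖ ≤ ‖a + b‖ := by
  obtain ⟨hb, r, t, hr, ht, rfl⟩ := h
  obtain ⟨h2, h3⟩ := abs_le.1 (ht.trans hφ)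
  have hc : 0 ≤ Real.cos t := Real.cos_nonneg_of_mem_Icc ⟨h2, h3⟩
  rw [← sub_one_mul, ← add_one_mul, norm_mul, norm_mul]
  refine mul_le_mul_of_nonneg_right ?_ (norm_nonneg b)
  rw [Complex.norm_def, Complex.norm_def]
  apply Real.sqrt_le_sqrt
  simp only [Complex.normSq_apply, Complex.sub_re, Complex.add_re, Complex.sub_im, Complex.add_im,
    Complex.re_ofReal_mul, Complex.im_ofReal_mul, Complex.exp_ofReal_mul_I_re,
    Complex.exp_ofReal_mul_I_im, Complex.one_re, Complex.one_im]
  nlinarith [mul_nonneg hr.le hc]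

/-- The Möbius transformation `w ↦ (1 + w) / (1 - w)` maps the disk of radius `tan θ` into the
sector of half-angle `2 θ`. -/
lemma angleLE_one_add_one_sub {θ : ℝ} (h0 : 0 < θ) (h1 : θ < Real.pi / 4) {w : ℂ}
    (hw : ‖w‖ ≤ Real.tan θ) : AngleLE (2 * θ) (1 + w) (1 - w) := by
  have hT : Real.tan θ < 1 := by
    rw [← Real.tan_pi_div_four]
    exact Real.tan_lt_tan_of_lt_of_lt_pi_div_two (by linarith) (by linarith [Real.pi_pos]) h1
  have hT0 : 0 < Real.tan θ := Real.tan_pos_of_pos_of_lt_pi_div_two h0 (by linarith)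
  have hn := norm_nonneg w
  have hsub : 1 - w ≠ 0 := by
    intro h
    rw [← sub_eq_zero.1 h] at hw
    simp at hw
    linarith
  set R : ℂ := (1 + w) / (1 - w) with hR
  have hN : 0 < Complex.normSq (1 - w) := Complex.normSq_pos.2 hsub
  have hw2 : w.re ^ 2 + w.im ^ 2 = ‖w‖ ^ 2 := by
    rw [← Complex.normSq_eq_norm_sq, Complex.normSq_apply]; ring
  have hre : R.re = (1 - ‖w‖ ^ 2) / Complex.normSq (1 - w) := by
    rw [hR, Complex.div_re, ← hw2]
    simp
    ring
  have him : R.im = 2 * w.im / Complex.normSq (1 - w) := by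
    rw [hR, Complex.div_im]
    simp
    ring
  have hlt : 0 < 1 - ‖w‖ ^ 2 := by nlinarith
  have hRpos : 0 < R.re := by rw [hre]; positivity
  have hR0 : R ≠ 0 := by intro h; rw [h] at hRpos; simp at hRpos
  have harg : |R.arg| < Real.pi / 2 := Complex.abs_arg_lt_pi_div_two_iff.2 (Or.inl hRpos)
  -- Compare with tan 2θ = 2 tan θ / (1 - tan² θ), using |Im w| ≤ ‖w‖ ≤ tan θ.
  have htan : Real.tan R.arg = 2 * w.im / (1 - ‖w‖ ^ 2) := by
    rw [Complex.tan_arg, hre, him]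
    field_simp
  have htan2 : Real.tan (2 * θ) = 2 * Real.tan θ / (1 - Real.tan θ ^ 2) := Real.tan_two_mul
  have hbound : |2 * w.im / (1 - ‖w‖ ^ 2)| ≤ Real.tan (2 * θ) := by
    rw [htan2, abs_div, abs_of_pos hlt, abs_mul, abs_two]
    have : |w.im| ≤ ‖w‖ := Complex.abs_im_le_norm w
    apply div_le_div₀ <;> nlinarith
  obtain ⟨ha, hb⟩ := abs_lt.1 harg
  have hle : |R.arg| ≤ 2 * θ := by
    rw [← htan] at hbound
    obtain ⟨hc, hd⟩ := abs_le.1 hbound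
    rw [abs_le]
    constructor
    · by_contra! hlt
      have := Real.tan_lt_tan_of_lt_of_lt_pi_div_two ha (by linarith) hlt
      rw [Real.tan_neg] at this
      linarith
    · by_contra! hlt
      have := Real.tan_lt_tan_of_lt_of_lt_pi_div_two (by linarith) hb hlt
      linarith
  refine ⟨hsub, ‖R‖, R.arg, norm_pos_iff.2 hR0, hle, ?_⟩
  rw [Complex.norm_mul_exp_arg_mul_I, hR, div_mul_cancel₀ _ hsub]

/-- Passing the pair `(S₀, S₁)` through an edge of interaction `β` contracts the angle. -/
lemma angleLE_edge {θ : ℝ} (h0 : 0 < θ) (h1 : θ < Real.pi / 4) {β : ℂ} (hβ : β ≠ -1)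
    (hβθ : ‖β - 1‖ / ‖β + 1‖ ≤ Real.tan θ) {S₀ S₁ : ℂ} (hS : S₀ + S₁ ≠ 0)
    (hle : ‖S₀ - S₁‖ ≤ ‖S₀ + S₁‖) : AngleLE (2 * θ) (β * S₀ + S₁) (S₀ + β * S₁) := by
  have hβ1 : β + 1 ≠ 0 := fun h => hβ (eq_neg_of_add_eq_zero_left h)
  have hw : ‖(β - 1) / (β + 1) * ((S₀ - S₁) / (S₀ + S₁))‖ ≤ Real.tan θ := by
    rw [norm_mul, norm_div, norm_div]
    have : ‖S₀ - S₁‖ / ‖S₀ + S₁‖ ≤ 1 := div_le_one_of_le₀ hle (norm_nonneg _)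
    exact (mul_le_of_le_one_right (by positivity) this).trans hβθ
  -- With this c and w the product in `hw`, c(1 + w) = βS₀ + S₁ and c(1 - w) = S₀ + βS₁.
  have key := (angleLE_one_add_one_sub h0 h1 hw).mul_left
    (c := (β + 1) * (S₀ + S₁) / 2) (by simp [hβ1, hS])
  convert key using 1 <;> field_simp <;> ring

end Ising

/-! ### Half-edge systems and the induction on free half-edges. -/

namespace Ising

section HalfEdges

variable {V E : Type*} [Fintype V] [DecidableEq V] [Fintype E] [DecidableEq E]

/-- The spin at the end of a half-edge, which is attached to a vertex or pinned to a spin. -/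
def endSpin (σ : V → Fin 2) : V ⊕ Fin 2 → Fin 2 := Sum.elim σ id

/-- The weight of the edge `e` under `σ`, the half-edges being attached by `h`. -/
def edgeWeight (β : ℂ) (h : E × Bool → V ⊕ Fin 2) (σ : V → Fin 2) (e : E) : ℂ :=
  if endSpin σ (h (e, false)) = endSpin σ (h (e, true)) then β else 1

/-- The Ising partition function of a system of half-edges, some of which may be pinned. -/
def halfEdgeZ (β : ℂ) (h : E × Bool → V ⊕ Fin 2) : ℂ :=
  ∑ σ : V → Fin 2, ∏ e, edgeWeight β h σ e

/-- The partition function with the edge `e` omitted. -/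
def halfEdgeZErase (β : ℂ) (h : E × Bool → V ⊕ Fin 2) (e : E) : ℂ :=
  ∑ σ : V → Fin 2, ∏ e' ∈ Finset.univ.erase e, edgeWeight β h σ e'

/-- Pin the half-edges in `X` to the spin `c`. -/
def pin (X : Finset (E × Bool)) (c : Fin 2) (h : E × Bool → V ⊕ Fin 2) :
    E × Bool → V ⊕ Fin 2 :=
  fun x => if x ∈ X then Sum.inr c else h x

/-- The half-edges attached to the vertex `v`. -/
def halfEdgesAt (h : E × Bool → V ⊕ Fin 2) (v : V) : Finset (E × Bool) :=
  Finset.univ.filter fun x => h x = Sum.inl v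

/-- The half-edges that are not pinned. -/
def freeHalfEdges (h : E × Bool → V ⊕ Fin 2) : Finset (E × Bool) :=
  Finset.univ.filter fun x => (h x).isLeft

variable {β : ℂ} {h : E × Bool → V ⊕ Fin 2}

omit [Fintype V] [DecidableEq V] in
lemma freeHalfEdges_pin (X : Finset (E × Bool)) (c : Fin 2) :
    freeHalfEdges (pin X c h) = freeHalfEdges h \ X := by
  ext x
  simp only [freeHalfEdges, Finset.mem_filter, Finset.mem_univ, true_and, Finset.mem_sdiff]
  by_cases hx : x ∈ X <;> simp [pin, hx]

omit [Fintype V] in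
lemma halfEdgesAt_pin (X : Finset (E × Bool)) (c : Fin 2) (v : V) :
    halfEdgesAt (pin X c h) v = halfEdgesAt h v \ X := by
  ext x
  simp only [halfEdgesAt, Finset.mem_filter, Finset.mem_univ, true_and, Finset.mem_sdiff]
  by_cases hx : x ∈ X <;> simp [pin, hx]

omit [Fintype V] in
lemma card_halfEdgesAt_pin_le {Δ : ℕ} (hdeg : ∀ v, (halfEdgesAt h v).card ≤ Δ)
    (X : Finset (E × Bool)) (c : Fin 2) (v : V) : (halfEdgesAt (pin X c h) v).card ≤ Δ := by
  rw [halfEdgesAt_pin]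
  exact (Finset.card_le_card Finset.sdiff_subset).trans (hdeg v)

omit [Fintype V] in
lemma endSpin_pin_halfEdgesAt (σ : V → Fin 2) (v : V) (c : Fin 2) (x : E × Bool) :
    endSpin σ (pin (halfEdgesAt h v) c h x) = endSpin (Function.update σ v c) (h x) := by
  by_cases hx : h x = Sum.inl v
  · simp [pin, halfEdgesAt, hx, endSpin]
  · rcases hh : h x with u | d
    · have : u ≠ v := by rintro rfl; exact hx hh
      simp [pin, halfEdgesAt, hh, endSpin, this]
    · simp [pin, halfEdgesAt, hh, endSpin]

/-- The two updates of σ are σ and its flip at v, and flipping is an involution. -/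
lemma sum_update_add_sum_update (F : (V → Fin 2) → ℂ) (v : V) :
    ∑ σ, F (Function.update σ v 0) + ∑ σ, F (Function.update σ v 1) = 2 * ∑ σ, F σ := by
  have hinv : Function.Involutive fun σ : V → Fin 2 => Function.update σ v (1 - σ v) := by
    intro σ
    simp
  conv_rhs =>
    rw [two_mul]
    arg 2
    rw [← Equiv.sum_comp hinv.toPerm F]
  rw [← Finset.sum_add_distrib, ← Finset.sum_add_distrib]
  refine Finset.sum_congr rfl fun σ _ => ?_
  have hσ : ∀ c, σ v = c → Function.update σ v c = σ := by rintro c rfl; simp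
  have h01 : σ v = 0 ∨ σ v = 1 := by omega
  simp only [Function.Involutive.coe_toPerm]
  rcases h01 with h0 | h1
  · rw [hσ 0 h0, h0, sub_zero]
  · rw [hσ 1 h1, h1, sub_self, add_comm]

/-- Conditioning on the spin of a vertex amounts to pinning its half-edges. -/
lemma halfEdgeZ_pin_add_pin (v : V) :
    halfEdgeZ β (pin (halfEdgesAt h v) 0 h) + halfEdgeZ β (pin (halfEdgesAt h v) 1 h) =
      2 * halfEdgeZ β h := by
  simp only [halfEdgeZ, edgeWeight, endSpin_pin_halfEdgesAt]
  exact sum_update_add_sum_update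
    (fun σ => ∏ e, if endSpin σ (h (e, false)) = endSpin σ (h (e, true)) then β else 1) v

lemma halfEdgeZErase_congr {h' : E × Bool → V ⊕ Fin 2} {e : E}
    (hh : ∀ x : E × Bool, x.1 ≠ e → h x = h' x) :
    halfEdgeZErase β h e = halfEdgeZErase β h' e := by
  refine Finset.sum_congr rfl fun σ _ => Finset.prod_congr rfl fun e' he' => ?_
  have := Finset.ne_of_mem_erase he'
  simp [edgeWeight, hh (e', _) this]

lemma halfEdgeZ_of_pinned {e : E} {i : Bool} {c d : Fin 2} (hc : h (e, i) = Sum.inr c)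
    (hd : h (e, !i) = Sum.inr d) :
    halfEdgeZ β h = (if c = d then β else 1) * halfEdgeZErase β h e := by
  rw [halfEdgeZ, halfEdgeZErase, Finset.mul_sum]
  refine Finset.sum_congr rfl fun σ _ => ?_
  rw [← Finset.mul_prod_erase _ _ (Finset.mem_univ e)]
  congr 1
  cases i <;> simp_all [edgeWeight, endSpin, eq_comm]

omit [DecidableEq E] in
lemma halfEdgeZ_ne_zero_of_freeHalfEdges_eq_empty (hβ : β ≠ 0) (hh : freeHalfEdges h = ∅) :
    halfEdgeZ β h ≠ 0 := by
  have hc : ∀ x, ∃ c, h x = Sum.inr c := by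
    intro x
    rcases hx : h x with u | c
    · have : x ∈ freeHalfEdges h := by simp [freeHalfEdges, hx]
      simp [hh] at this
    · exact ⟨c, rfl⟩
  choose f hf using hc
  simp only [halfEdgeZ, edgeWeight, hf, endSpin, Sum.elim_inr, Finset.sum_const,
    nsmul_eq_mul]
  refine mul_ne_zero (by simp) (Finset.prod_ne_zero_iff.2 fun e _ => ?_)
  split_ifs
  · exact hβ
  · exact one_ne_zero

/-- Pinning the half-edges of a set one after the other, each of which costs an angle `φ`. -/
lemma angleLE_pin {Δ n : ℕ} {φ : ℝ}
    (hne : ∀ h : E × Bool → V ⊕ Fin 2, (freeHalfEdges h).card ≤ n →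
      (∀ v, (halfEdgesAt h v).card ≤ Δ) → halfEdgeZ β h ≠ 0)
    (hone : ∀ (h : E × Bool → V ⊕ Fin 2) (x : E × Bool), (freeHalfEdges h \ {x}).card ≤ n →
      (∀ v, (halfEdgesAt h v).card ≤ Δ) →
      AngleLE φ (halfEdgeZ β (pin {x} 0 h)) (halfEdgeZ β (pin {x} 1 h)))
    (X : Finset (E × Bool)) (h : E × Bool → V ⊕ Fin 2) (hn : (freeHalfEdges h \ X).card ≤ n)
    (hdeg : ∀ v, (halfEdgesAt h v).card ≤ Δ) :
    AngleLE (X.card * φ) (halfEdgeZ β (pin X 0 h)) (halfEdgeZ β (pin X 1 h)) := by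
  induction X using Finset.induction_on generalizing h with
  | empty =>
    have hp : ∀ c, pin ∅ c h = h := fun c => by funext x; simp [pin]
    simp only [hp, Finset.card_empty, Nat.cast_zero, zero_mul]
    exact AngleLE.refl (hne h (by simpa using hn) hdeg)
  | insert x X hx ih =>
    have hp : ∀ c d, pin X c (pin {x} d h) = pin {x} d (pin X c h) := by
      intro c d
      funext y
      by_cases hy : y = x
      · simp [pin, hy, hx]
      · simp [pin, hy]
    have hp' : ∀ c, pin {x} c (pin X c h) = pin (insert x X) c h := by
      intro c
      funext y
      by_cases hy : y = x <;> simp [pin, hy]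
    have hs : (freeHalfEdges h \ {x}) \ X = freeHalfEdges h \ insert x X := by
      ext y; simp [not_or, and_assoc]
    have hs' : (freeHalfEdges h \ X) \ {x} = freeHalfEdges h \ insert x X := by
      ext y; simp [not_or]; tauto
    -- Interpolate through the system with x pinned to 0 and X to 1.
    have h1 := ih (pin {x} 0 h) (by rwa [freeHalfEdges_pin, hs])
      (card_halfEdgesAt_pin_le hdeg _ _)
    have h2 := hone (pin X 1 h) x (by rwa [freeHalfEdges_pin, hs'])
      (card_halfEdgesAt_pin_le hdeg _ _)
    rw [hp, hp, hp'] at h1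
    rw [hp'] at h2
    have := h1.trans h2
    rw [Finset.card_insert_of_notMem hx]
    push_cast
    rwa [add_one_mul]

/-- The angle between the two partition functions obtained by pinning a half-edge to `0` and
to `1`, from the angles for smaller systems. -/
lemma angleLE_pin_singleton {Δ n : ℕ} {φ : ℝ} (hφ : 0 ≤ φ) (hβ : β ≠ 0)
    (hΔφ : ((Δ : ℝ) - 1) * φ ≤ Real.pi / 2)
    (hedge : ∀ S₀ S₁ : ℂ, S₀ + S₁ ≠ 0 → ‖S₀ - S₁‖ ≤ ‖S₀ + S₁‖ →
      AngleLE φ (β * S₀ + S₁) (S₀ + β * S₁))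
    (hne : ∀ h : E × Bool → V ⊕ Fin 2, (freeHalfEdges h).card ≤ n →
      (∀ v, (halfEdgesAt h v).card ≤ Δ) → halfEdgeZ β h ≠ 0)
    (hset : ∀ (X : Finset (E × Bool)) (h : E × Bool → V ⊕ Fin 2),
      (freeHalfEdges h \ X).card < n → (∀ v, (halfEdgesAt h v).card ≤ Δ) →
      AngleLE (X.card * φ) (halfEdgeZ β (pin X 0 h)) (halfEdgeZ β (pin X 1 h)))
    (x : E × Bool) (hn : (freeHalfEdges h \ {x}).card ≤ n)
    (hdeg : ∀ v, (halfEdgesAt h v).card ≤ Δ) :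
    AngleLE φ (halfEdgeZ β (pin {x} 0 h)) (halfEdgeZ β (pin {x} 1 h)) := by
  obtain ⟨e, i⟩ := x
  have hi : (!i) ≠ i := by cases i <;> simp
  rcases hy : h (e, !i) with u | d
  · set X : Finset (E × Bool) := (halfEdgesAt h u).erase (e, i) with hX
    have hyX : (e, !i) ∈ X := by simp [hX, halfEdgesAt, hy, hi]
    set S : Fin 2 → ℂ := fun c => halfEdgeZErase β (pin X c h) e with hS
    have hXat : ∀ d, halfEdgesAt (pin {(e, i)} d h) u = X := by
      intro d
      rw [halfEdgesAt_pin, hX, Finset.erase_eq]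
    have hZ : ∀ d c, halfEdgeZ β (pin X c (pin {(e, i)} d h)) = (if d = c then β else 1) * S c := by
      intro d c
      rw [halfEdgeZ_of_pinned (e := e) (i := i) (c := d) (d := c) (by simp [pin, hX])
        (by simp [pin, hyX])]
      congr 1
      refine halfEdgeZErase_congr fun x hx => ?_
      have : x ≠ (e, i) := by rintro rfl; exact hx rfl
      simp [pin, this]
    have hsum : ∀ d, (if d = 0 then β else 1) * S 0 + (if d = 1 then β else 1) * S 1 =
        2 * halfEdgeZ β (pin {(e, i)} d h) := by
      intro d
      rw [← hZ, ← hZ, ← halfEdgeZ_pin_add_pin u, hXat]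
    -- Pinning both ends of e to 0 turns it into a constant factor β ≠ 0, so S is reached without
    -- deleting an edge, and one more half-edge is pinned, as `hset` requires.
    set g := pin {(e, i), (e, !i)} 0 h with hg
    set X' := X.erase (e, !i) with hX'
    have hZ' : ∀ c, halfEdgeZ β (pin X' c g) = β * S c := by
      intro c
      rw [halfEdgeZ_of_pinned (e := e) (i := i) (c := 0) (d := 0) (by simp [pin, hX', hX, hg])
        (by simp [pin, hX', hg]), if_pos rfl]
      congr 1
      refine halfEdgeZErase_congr fun x hx => ?_
      have h1 : x ≠ (e, i) := by rintro rfl; exact hx rfl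
      have h2 : x ≠ (e, !i) := by rintro rfl; exact hx rfl
      simp [pin, h1, h2, hg, hX']
    have hcard : X'.card + 1 ≤ Δ := by
      rw [hX', Finset.card_erase_add_one hyX]
      exact (Finset.card_le_card (Finset.erase_subset _ _)).trans (hdeg u)
    have hlt : (freeHalfEdges g \ X').card < n := by
      refine lt_of_lt_of_le (Finset.card_lt_card ?_) hn
      rw [hg, freeHalfEdges_pin]
      refine (Finset.ssubset_iff_of_subset ?_).2 ⟨(e, !i), ?_, ?_⟩
      · intro x
        simp only [Finset.mem_sdiff, Finset.mem_insert, Finset.mem_singleton]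
        tauto
      · simp [freeHalfEdges, hy, hi]
      · simp
    have key := hset X' g hlt (card_halfEdgesAt_pin_le hdeg _ _)
    rw [hZ', hZ'] at key
    replace key := key.of_mul_left hβ
    have hang : X'.card * φ ≤ Real.pi / 2 := by
      refine le_trans (mul_le_mul_of_nonneg_right ?_ hφ) hΔφ
      have : ((X'.card : ℝ) + 1) ≤ Δ := by exact_mod_cast hcard
      linarith
    have h2 := hedge (S 0) (S 1) (key.add_ne_zero (by linarith [Real.pi_pos]))
      (key.norm_sub_le hang)
    have e0 := hsum 0
    have e1 := hsum 1
    simp only [if_true, zero_ne_one, one_ne_zero, if_false, one_mul] at e0 e1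
    rw [e0, e1] at h2
    exact h2.of_mul_left two_ne_zero
  · set W := halfEdgeZErase β h e with hW
    have hZ : ∀ c, halfEdgeZ β (pin {(e, i)} c h) = (if c = d then β else 1) * W := by
      intro c
      rw [halfEdgeZ_of_pinned (e := e) (i := i) (c := c) (d := d) (by simp [pin])
        (by simp [pin, hi, hy])]
      congr 1
      refine halfEdgeZErase_congr fun x hx => ?_
      have h1 : x ≠ (e, i) := by rintro rfl; exact hx rfl
      simp [pin, h1]
    have hW0 : W ≠ 0 := by
      have := hne (pin {(e, i)} d h) (by rwa [freeHalfEdges_pin])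
        (card_halfEdgesAt_pin_le hdeg _ _)
      rw [hZ] at this
      exact right_ne_zero_of_mul this
    rw [hZ, hZ]
    have hd : d = 0 ∨ d = 1 := by omega
    rcases hd with rfl | rfl
    -- A pinned far end is the degenerate case where one S_c vanishes.
    · simpa using hedge W 0 (by simpa using hW0) (by simp)
    · simpa using hedge 0 W (by simpa using hW0) (by simp)

/-- Absence of zeros for systems of half-edges of bounded degree. -/
lemma halfEdgeZ_ne_zero {Δ : ℕ} {φ : ℝ} (hφ : 0 ≤ φ) (hβ : β ≠ 0)
    (hΔφ : ((Δ : ℝ) - 1) * φ ≤ Real.pi / 2) (hΔφ' : Δ * φ < Real.pi)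
    (hedge : ∀ S₀ S₁ : ℂ, S₀ + S₁ ≠ 0 → ‖S₀ - S₁‖ ≤ ‖S₀ + S₁‖ →
      AngleLE φ (β * S₀ + S₁) (S₀ + β * S₁))
    (hdeg : ∀ v, (halfEdgesAt h v).card ≤ Δ) : halfEdgeZ β h ≠ 0 := by
  -- The half-edge x is not counted in the second claim: at level n that claim needs nonvanishing at
  -- n and angles below n, while nonvanishing at n + 1 needs angles at n.
  suffices H : ∀ n : ℕ,
      (∀ h : E × Bool → V ⊕ Fin 2, (freeHalfEdges h).card ≤ n →
        (∀ v, (halfEdgesAt h v).card ≤ Δ) → halfEdgeZ β h ≠ 0) ∧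
      (∀ (h : E × Bool → V ⊕ Fin 2) (x : E × Bool), (freeHalfEdges h \ {x}).card ≤ n →
        (∀ v, (halfEdgesAt h v).card ≤ Δ) →
        AngleLE φ (halfEdgeZ β (pin {x} 0 h)) (halfEdgeZ β (pin {x} 1 h))) from
    (H _).1 h le_rfl hdeg
  intro n
  induction n with
  | zero =>
    have hne : ∀ h : E × Bool → V ⊕ Fin 2, (freeHalfEdges h).card ≤ 0 →
        (∀ v, (halfEdgesAt h v).card ≤ Δ) → halfEdgeZ β h ≠ 0 := fun h hh _ =>
      halfEdgeZ_ne_zero_of_freeHalfEdges_eq_empty hβ (by simpa using hh)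
    exact ⟨hne, fun h x => angleLE_pin_singleton hφ hβ hΔφ hedge hne
      (fun _ _ hlt => absurd hlt (Nat.not_lt_zero _)) x⟩
  | succ n ih =>
    have hset := angleLE_pin ih.1 ih.2
    have hne : ∀ h : E × Bool → V ⊕ Fin 2, (freeHalfEdges h).card ≤ n + 1 →
        (∀ v, (halfEdgesAt h v).card ≤ Δ) → halfEdgeZ β h ≠ 0 := by
      intro h hh hdeg
      rcases (freeHalfEdges h).eq_empty_or_nonempty with h0 | ⟨x, hx⟩
      · exact halfEdgeZ_ne_zero_of_freeHalfEdges_eq_empty hβ h0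
      obtain ⟨v, hv⟩ := Sum.isLeft_iff.1 (Finset.mem_filter.1 hx).2
      have hlt : (freeHalfEdges h \ halfEdgesAt h v).card < (freeHalfEdges h).card := by
        refine Finset.card_lt_card
          ((Finset.ssubset_iff_of_subset Finset.sdiff_subset).2 ⟨x, hx, ?_⟩)
        simp [halfEdgesAt, hv]
      have key := (hset (halfEdgesAt h v) h (by omega) hdeg).add_ne_zero
        (lt_of_le_of_lt (mul_le_mul_of_nonneg_right (by exact_mod_cast hdeg v) hφ) hΔφ')
      rw [halfEdgeZ_pin_add_pin] at key
      exact right_ne_zero_of_mul key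
    exact ⟨hne, fun h x => angleLE_pin_singleton hφ hβ hΔφ hedge hne
      (fun X h hlt => hset X h (Nat.lt_succ_iff.1 hlt)) x⟩

end HalfEdges

end Ising

/-! ### From multigraphs to half-edges. -/

namespace Ising

section Transfer

variable {α ε : Type*} {G : Graph α ε}

/-- A multigraph as a system of half-edges, given a choice of the two ends of every edge. -/
def graphHalfEdges (a b : E(G) → V(G)) : E(G) × Bool → V(G) ⊕ Fin 2 :=
  fun x => Sum.inl (if x.2 then b x.1 else a x.1)

lemma halfEdgeZ_graphHalfEdges [Fintype V(G)] [DecidableEq V(G)] [Fintype E(G)]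
    [DecidableEq E(G)] {a b : E(G) → V(G)} (hab : ∀ e : E(G), G.IsLink e (a e) (b e)) (β : ℂ) :
    halfEdgeZ β (graphHalfEdges a b) = partitionFunction G β := by
  rw [partitionFunction, finsum_eq_sum_of_fintype, halfEdgeZ]
  refine Finset.sum_congr rfl fun σ _ => ?_
  have hset : monochromaticEdges G σ =
      Subtype.val '' ((Finset.univ.filter fun e : E(G) => σ (a e) = σ (b e) : Finset E(G)) :
        Set E(G)) := by
    ext e
    constructor
    · rintro ⟨x, y, hxy, hσ⟩
      refine ⟨⟨e, hxy.edge_mem⟩, ?_, rfl⟩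
      rcases (hab ⟨e, hxy.edge_mem⟩).eq_and_eq_or_eq_and_eq hxy with ⟨h1, h2⟩ | ⟨h1, h2⟩
      · simp [Subtype.ext h1, Subtype.ext h2, hσ]
      · simp [Subtype.ext h1, Subtype.ext h2, hσ]
    · rintro ⟨e, he, rfl⟩
      exact ⟨a e, b e, hab e, by simpa using he⟩
  rw [hset, Set.ncard_image_of_injective _ Subtype.val_injective, Set.ncard_coe_finset]
  simp [edgeWeight, graphHalfEdges, endSpin, Finset.prod_ite]

/-- Incident edges form A ∪ B and loops A ∩ B, so the degree is |A| + |B|. -/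
lemma card_halfEdgesAt_graphHalfEdges [Fintype V(G)] [DecidableEq V(G)] [Fintype E(G)]
    [DecidableEq E(G)] {a b : E(G) → V(G)} (hab : ∀ e : E(G), G.IsLink e (a e) (b e)) (v : V(G)) :
    (halfEdgesAt (graphHalfEdges a b) v).card = degree G v := by
  set A : Finset E(G) := Finset.univ.filter fun e => a e = v with hA
  set B : Finset E(G) := Finset.univ.filter fun e => b e = v with hB
  have hinc : G.incidenceSet v = Subtype.val '' ((A ∪ B : Finset E(G)) : Set E(G)) := by
    ext e
    constructor
    · rintro ⟨y, hy⟩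
      refine ⟨⟨e, hy.edge_mem⟩, ?_, rfl⟩
      rcases (hab ⟨e, hy.edge_mem⟩).eq_and_eq_or_eq_and_eq hy with ⟨h1, -⟩ | ⟨-, h2⟩
      · simp [hA, Subtype.ext h1]
      · simp [hB, Subtype.ext h2]
    · rintro ⟨e, he, rfl⟩
      simp only [hA, hB, Finset.coe_union, Finset.coe_filter, Finset.mem_univ, true_and,
        Set.mem_union, Set.mem_ofPred_eq] at he
      rcases he with rfl | rfl
      · exact (hab e).inc_left
      · exact (hab e).inc_right
  have hloop : G.loopSet v = Subtype.val '' ((A ∩ B : Finset E(G)) : Set E(G)) := by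
    ext e
    constructor
    · intro hy
      replace hy : G.IsLink e v v := hy
      refine ⟨⟨e, hy.edge_mem⟩, ?_, rfl⟩
      rcases (hab ⟨e, hy.edge_mem⟩).eq_and_eq_or_eq_and_eq hy with ⟨h1, h2⟩ | ⟨h1, h2⟩ <;>
      simp [hA, hB, Subtype.ext h1, Subtype.ext h2]
    · rintro ⟨e, he, rfl⟩
      simp only [hA, hB, Finset.coe_inter, Finset.coe_filter, Finset.mem_univ, true_and,
        Set.mem_inter_iff, Set.mem_ofPred_eq] at he
      have := hab e
      rw [he.1, he.2] at this
      exact this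
  rw [degree, hinc, hloop, Set.ncard_image_of_injective _ Subtype.val_injective,
    Set.ncard_image_of_injective _ Subtype.val_injective, Set.ncard_coe_finset,
    Set.ncard_coe_finset, Finset.card_union_add_card_inter, hA, hB, halfEdgesAt,
    Finset.card_filter, Finset.card_filter, Finset.card_filter, Fintype.sum_prod_type]
  simp only [Fintype.sum_bool, graphHalfEdges, Sum.inl.injEq, if_true, Finset.sum_add_distrib]
  simp [add_comm]

end Transfer

end Ising

theorem theorem1 {α ε : Type*} (Δ : ℕ) (hΔ : 3 ≤ Δ)
    (G : Graph α ε) (hV : V(G).Finite) (hE : E(G).Finite) (hG : Ising.MaxDegreeLE G Δ) :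
    Ising.radius Δ ∈ Set.Ioo (0 : ℝ) 1 ∧
      ∀ β : ℂ, β ≠ -1 → ‖β - 1‖ / ‖β + 1‖ ≤ Ising.radius Δ →
        Ising.partitionFunction G β ≠ 0 := by
  classical
  have hΔ' : (3 : ℝ) ≤ Δ := by exact_mod_cast hΔ
  have hpi := Real.pi_pos
  set θ : ℝ := Real.pi / (4 * ((Δ : ℝ) - 1)) with hθ
  have hθΔ : ((Δ : ℝ) - 1) * (2 * θ) = Real.pi / 2 := by
    have : (Δ : ℝ) - 1 ≠ 0 := by linarith
    rw [hθ]; field_simp; norm_num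
  have h0 : 0 < θ := div_pos hpi (by linarith)
  have h1 : θ < Real.pi / 4 := by nlinarith
  have hr : Ising.radius Δ = Real.tan θ := rfl
  rw [hr]
  refine ⟨⟨Real.tan_pos_of_pos_of_lt_pi_div_two h0 (by linarith), ?_⟩, fun β hβ hβθ => ?_⟩
  · rw [← Real.tan_pi_div_four]
    exact Real.tan_lt_tan_of_lt_of_lt_pi_div_two (by linarith) (by linarith) h1
  have hedge := fun S₀ S₁ => Ising.angleLE_edge h0 h1 hβ hβθ (S₀ := S₀) (S₁ := S₁)
  -- At S = (1, 0) the left-hand value of `hedge` is β itself.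
  have hβ0 : β ≠ 0 := by
    simpa using (hedge 1 0 (by simp) (by simp)).ne_zero_left
  have := hV.fintype
  have := hE.fintype
  have hends : ∀ e : E(G), ∃ x y : V(G), G.IsLink e x y := by
    intro e
    obtain ⟨x, y, hxy⟩ := G.exists_isLink_of_mem_edgeSet e.2
    exact ⟨⟨x, hxy.left_mem⟩, ⟨y, hxy.right_mem⟩, hxy⟩
  choose a b hab using hends
  rw [← Ising.halfEdgeZ_graphHalfEdges hab]
  -- Δφ = π/2 + φ < π because θ < π/4, which is where Δ > 2 enters.
  refine Ising.halfEdgeZ_ne_zero (Δ := Δ) (by linarith) hβ0 hθΔ.le (by nlinarith) hedge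
    fun v => ?_
  rw [Ising.card_halfEdgesAt_graphHalfEdges hab]
  exact hG v v.2
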